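/- Let $p$ be an odd prime, let $d,c$ be positive integers with $c,d,p$ pairwise coprime, and let $m\ge 1$. Let $R$ be a complete non-Archimedean normed commutative $\mathbb{Q}_p$-algebra, nontrivial and without zero divisors. Let $\chi$ be an even Dirichlet character of level $dp^m$ with values in $R$ (i.e. $\chi(-1)=1$) whose conductor is divisible by $d$. Notation. Let $\omega$ be the Teichmüller character modulo $p$ with values in $\mathbb{Z}_p$, viewed in $R$ through the structure map, and put $\langle a\rangle=\omega^{-1}(a)\,a$ for $a\in\mathbb{Z}_p^\times$. For $k\ge 0$, $\chi\omega^{-k}$ denotes the primitive Dirichlet character associated to the product of $\chi$ and $\omega^{-k}$. For a primitive Dirichlet character $\psi$ of conductor $f$, the generalized Bernoulli numbers are $$B_{k,\psi}=f^{k-1}\sum_{a=1}^{f}\psi(a)\,B_k\!\left(\tfrac{a}{f}\right),$$ with $B_k(X)$ the Bernoulli polynomials. Let $X=(\mathbb{Z}/d\mathbb{Z})^\times\times\mathbb{Z}_p^\times$. The Bernoulli measure $E_c$ is the bounded $R$-linear functional on the locally constant functions $X\to R$ determined as follows: for $N=dp^j$ with $j\ge1$ and $a\in(\mathbb{Z}/N\mathbb{Z})^\times$,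 its value on the characteristic function of $\{x\in X: x\equiv a \bmod N\}$ is $$\left\{\frac{a}{N}\right\}-c\left\{\frac{c^{-1}a}{N}\right\}+\frac{c-1}{2},$$ where $\{\cdot\}$ is the fractional part and $c^{-1}$ is an inverse of $c$ modulo $N$. The integral $\int_X f\,dE_c$ of a continuous $f:X\to R$ is given by the unique continuous $R$-linear extension of $E_c$ to the space $C(X,R)$ with the supremum norm. For a continuous monoid homomorphism $w:X\to R$ (a weight), the $p$-adic $L$-function is $$L_p(w,\chi)=\int_X \chi\omega^{-1}(a)\,w(a)\,dE_c(a),$$ where $\chi\omega^{-1}$ is regarded as a function on $X$ by reduction modulo $dp^m$. For $k\ge 0$ write $\langle\cdot\rangle^k$ for the weight $(b,a)\mapsto\langle a\rangle^k$ with $b\in(\mathbb{Z}/d\mathbb{Z})^\times$, $a\in\mathbb{Z}_p^\times$. Then for every integer $n>1$, $$L_p\big(\langle\cdot\rangle^{n-1},\chi\big)=\frac1n\,\big(1-\chi(c)\langle c\rangle^{n}\big)\,\big(1-\chi\omega^{-n}(p)\,p^{n-1}\big)\,B_{n,\chi\omega^{-n}}.$$ -/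

import Mathlib

noncomputable section

namespace PadicL

open Filter Topology

section Measures

variable {X R : Type*} [TopologicalSpace X] [CompactSpace X] [NormedCommRing R]

/-- The inclusion `LC(X, R) → C(X, R)`. -/
abbrev lcIncl (X R : Type*) [TopologicalSpace X] [CompactSpace X] [NormedCommRing R] :
    LocallyConstant X R →ₗ[R] C(X, R) :=
  LocallyConstant.toContinuousMapLinearMap R

/-- Measures on `X` with values in `R`: bounded distributions. -/
def Measures (X R : Type*) [TopologicalSpace X] [CompactSpace X] [NormedCommRing R] : Type _ :=
  {φ : LocallyConstant X R →ₗ[R] R //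
    ∃ K : ℝ, 0 < K ∧ ∀ f : LocallyConstant X R, ‖φ f‖ ≤ K * ‖lcIncl X R f‖}

theorem lcIncl_injective : Function.Injective (lcIncl X R) := by
  intro f g h
  ext x
  exact congrArg (fun F : C(X, R) => F x) h

theorem denseRange_lcIncl [T2Space X] [TotallyDisconnectedSpace X] :
    DenseRange (lcIncl X R) := by
  intro f
  rw [Metric.mem_closure_range_iff]
  intro ε hε
  obtain ⟨n, g, h, hg, hgh⟩ := f.exists_finite_approximation_of_mem_nhds_diagonal
    (nhdsSet_diagonal_le_uniformity (Metric.dist_mem_uniformity (half_pos hε)))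
  refine ⟨⟨h ∘ g, ((IsLocallyConstant.iff_continuous g).2 hg).comp h⟩, ?_⟩
  refine lt_of_le_of_lt ?_ (half_lt_self hε)
  rw [ContinuousMap.dist_le (half_pos hε).le]
  intro x
  exact (hgh x).le

variable [CompleteSpace R]

/-- The integral against a measure: the continuous `R`-linear extension to `C(X, R)` of the
functional on the (dense) subspace of locally constant functions. -/
def Measures.integral (μ : Measures X R) : C(X, R) →L[R] R :=
  ((μ.1 ∘ₗ (LinearEquiv.ofInjective (lcIncl X R)
      lcIncl_injective).symm.toLinearMap).mkContinuousOfExistsBound (by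
    obtain ⟨K, -, hK⟩ := μ.2
    refine ⟨K, fun x => ?_⟩
    have h := hK ((LinearEquiv.ofInjective (lcIncl X R) lcIncl_injective).symm x)
    rwa [← LinearEquiv.ofInjective_apply (lcIncl X R) (h := lcIncl_injective),
      LinearEquiv.apply_symm_apply] at h)).extend
    (LinearMap.range (lcIncl X R)).subtypeL

theorem Measures.integral_coe [T2Space X] [TotallyDisconnectedSpace X] (μ : Measures X R)
    (f : LocallyConstant X R) : μ.integral (lcIncl X R f) = μ.1 f := by
  have hd : DenseRange (LinearMap.range (lcIncl X R)).subtypeL := by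
    have := denseRange_lcIncl (X := X) (R := R)
    simpa [DenseRange] using! this
  have := ContinuousLinearMap.extend_eq ((μ.1 ∘ₗ (LinearEquiv.ofInjective (lcIncl X R)
      lcIncl_injective).symm.toLinearMap).mkContinuousOfExistsBound (by
    obtain ⟨K, -, hK⟩ := μ.2
    refine ⟨K, fun x => ?_⟩
    have h := hK ((LinearEquiv.ofInjective (lcIncl X R) lcIncl_injective).symm x)
    rwa [← LinearEquiv.ofInjective_apply (lcIncl X R) (h := lcIncl_injective),
      LinearEquiv.apply_symm_apply] at h)) hd isUniformEmbedding_subtype_val.isUniformInducing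
      ⟨lcIncl X R f, LinearMap.mem_range_self _ f⟩
  refine this.trans ?_
  change μ.1 ((LinearEquiv.ofInjective (lcIncl X R) lcIncl_injective).symm _) = _
  congr 1
  rw [LinearEquiv.symm_apply_eq]
  rfl

end Measures

section Bern

/-- `E_{c}(a) = {a / N} - c {c⁻¹ a / N} + (c - 1) / 2` for a class `a` modulo `N`, where `c⁻¹` is an
inverse of `c` modulo `N`. -/
def bernoulliE (c N : ℕ) (a : ZMod N) : ℚ :=
  Int.fract ((a.val : ℚ) / N) - c * Int.fract ((((c : ZMod N)⁻¹ * a).val : ℚ) / N)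
    + ((c : ℚ) - 1) / 2

theorem bernoulliE_eq (c N : ℕ) [NeZero N] (a : ZMod N) :
    bernoulliE c N a = (a.val : ℚ) / N - c * ((((c : ZMod N)⁻¹ * a).val : ℚ) / N)
    + ((c : ℚ) - 1) / 2 := by
  have h : ∀ b : ZMod N, Int.fract ((b.val : ℚ) / N) = (b.val : ℚ) / N := by
    intro b
    have hN : (0 : ℚ) < N := by exact_mod_cast NeZero.pos N
    rw [Int.fract_eq_self]
    refine ⟨by positivity, ?_⟩
    rw [div_lt_one hN]
    exact_mod_cast ZMod.val_lt b
  rw [bernoulliE, h, h]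

/-- `E_c(a)` is the sum of an integer and `(c - 1) / 2`, hence bounded in `ℚ_p`. -/
theorem norm_bernoulliE_le (p : ℕ) [Fact p.Prime] (c N : ℕ) [NeZero N] (hc : c.Coprime N)
    (a : ZMod N) :
    ‖((bernoulliE c N a : ℚ) : ℚ_[p])‖ ≤ 1 + ‖(((c : ℚ) - 1) / 2 : ℚ_[p])‖ := by
  have hN : (N : ℚ) ≠ 0 := by exact_mod_cast NeZero.ne N
  obtain ⟨k, hk⟩ : ∃ k : ℤ, bernoulliE c N a = k + ((c : ℚ) - 1) / 2 := by
    have hz : ((((a.val : ℤ) - c * (((c : ZMod N)⁻¹ * a).val : ℤ) : ℤ)) : ZMod N) = 0 := by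
      push_cast
      rw [ZMod.natCast_zmod_val, ZMod.natCast_zmod_val, ← mul_assoc, ZMod.coe_mul_inv_eq_one _ hc,
        one_mul, sub_self]
    rw [ZMod.intCast_zmod_eq_zero_iff_dvd] at hz
    obtain ⟨k, hk⟩ := hz
    refine ⟨k, ?_⟩
    rw [bernoulliE_eq]
    have hk' : (a.val : ℚ) - c * (((c : ZMod N)⁻¹ * a).val : ℚ) = N * k := by exact_mod_cast hk
    rw [add_left_inj, ← mul_div_assoc, ← sub_div, hk', mul_div_cancel_left₀ _ hN]
  rw [hk]
  push_cast
  refine (norm_add_le _ _).trans (add_le_add_left ?_ _)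
  exact Padic.norm_int_le_one k

/-- The distribution relation: `E_c(x)` is the sum of `E_c(y)` over the lifts `y` of `x`. -/
theorem sum_bernoulliE (c N q : ℕ) [NeZero N] [NeZero q] (hc : c.Coprime (N * q)) (x : ZMod N) :
    ∑ y : ZMod (N * q) with ZMod.castHom (Dvd.intro q rfl) (ZMod N) y = x,
      bernoulliE c (N * q) y = bernoulliE c N x := by
  have hN : (N : ℚ) ≠ 0 := by exact_mod_cast NeZero.ne N
  have hq : (q : ℚ) ≠ 0 := by exact_mod_cast NeZero.ne q
  set π := ZMod.castHom (Dvd.intro q rfl : N ∣ N * q) (ZMod N) with hπ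
  have hfib : ∀ x : ZMod N, ∀ g : ℕ → ℚ, ∑ y : ZMod (N * q) with π y = x, g y.val
      = ∑ k ∈ Finset.range q, g (x.val + N * k) := by
    intro x g
    symm
    have hlt : ∀ k ∈ Finset.range q, x.val + N * k < N * q := by
      intro k hk
      have h1 := ZMod.val_lt x
      have h2 : k + 1 ≤ q := Finset.mem_range.1 hk
      nlinarith
    refine Finset.sum_bij (fun k _ => ((x.val + N * k : ℕ) : ZMod (N * q))) ?_ ?_ ?_ ?_
    · intro k hk
      simp only [Finset.mem_filter, Finset.mem_univ, true_and]
      rw [map_natCast, Nat.cast_add, Nat.cast_mul, ZMod.natCast_self, zero_mul, add_zero,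
        ZMod.natCast_zmod_val]
    · intro k hk l hl h
      have := congrArg ZMod.val h
      rw [ZMod.val_cast_of_lt (hlt k hk), ZMod.val_cast_of_lt (hlt l hl)] at this
      exact Nat.eq_of_mul_eq_mul_left (NeZero.pos N) (Nat.add_left_cancel this)
    · intro y hy
      have hy' : π y = x := by simpa using hy
      have hx : x.val = y.val % N := by
        rw [← hy', ← ZMod.natCast_zmod_val y, hπ, map_natCast, ZMod.val_natCast,
          ZMod.natCast_zmod_val]
      refine ⟨y.val / N, ?_, ?_⟩
      · rw [Finset.mem_range, Nat.div_lt_iff_lt_mul (NeZero.pos N)]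
        exact (ZMod.val_lt y).trans_eq (mul_comm N q)
      · rw [hx, Nat.mod_add_div, ZMod.natCast_zmod_val]
    · intro k hk
      rw [ZMod.val_cast_of_lt (hlt k hk)]
  have hsum : ∀ x : ZMod N, ∑ y : ZMod (N * q) with π y = x, (y.val : ℚ) / (N * q : ℕ)
      = (x.val : ℚ) / N + ((q : ℚ) - 1) / 2 := by
    intro x
    rw [hfib x (fun v => (v : ℚ) / (N * q : ℕ)), ← Finset.sum_div]
    push_cast
    rw [Finset.sum_add_distrib, ← Finset.mul_sum, Finset.sum_const, Finset.card_range]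
    have hg : ∀ r : ℕ, ∑ k ∈ Finset.range r, (k : ℚ) = r * (r - 1) / 2 := by
      intro r
      induction r with
      | zero => simp
      | succ r ih => rw [Finset.sum_range_succ, ih]; push_cast; ring
    rw [hg, nsmul_eq_mul]
    field_simp
  have hcu : (c : ZMod (N * q)) * (c : ZMod (N * q))⁻¹ = 1 := ZMod.coe_mul_inv_eq_one _ hc
  have hcN : (c : ZMod N) * (c : ZMod N)⁻¹ = 1 :=
    ZMod.coe_mul_inv_eq_one _ (Nat.Coprime.coprime_mul_right_right hc)
  have hπc : π (c : ZMod (N * q))⁻¹ = (c : ZMod N)⁻¹ := by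
    have h1 : (c : ZMod N) * π (c : ZMod (N * q))⁻¹ = 1 := by
      rw [← map_natCast π c, ← map_mul, hcu, map_one]
    calc _ = ((c : ZMod N) * (c : ZMod N)⁻¹) * π (c : ZMod (N * q))⁻¹ := by rw [hcN, one_mul]
      _ = (c : ZMod N)⁻¹ * ((c : ZMod N) * π (c : ZMod (N * q))⁻¹) := by ring
      _ = _ := by rw [h1, mul_one]
  have hmul : ∀ x : ZMod N, ∑ y : ZMod (N * q) with π y = x,
      ((((c : ZMod (N * q))⁻¹ * y).val : ℕ) : ℚ) / (N * q : ℕ)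
      = ∑ y : ZMod (N * q) with π y = (c : ZMod N)⁻¹ * x, (y.val : ℚ) / (N * q : ℕ) := by
    intro x
    refine Finset.sum_bij' (fun y _ => (c : ZMod (N * q))⁻¹ * y) (fun y _ => (c : ZMod (N * q)) * y)
      ?_ ?_ ?_ ?_ ?_
    · intro y hy
      have hy' : π y = x := by simpa using hy
      simp only [Finset.mem_filter, Finset.mem_univ, true_and]
      rw [map_mul, hπc, hy']
    · intro y hy
      have hy' : π y = (c : ZMod N)⁻¹ * x := by simpa using hy
      simp only [Finset.mem_filter, Finset.mem_univ, true_and]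
      rw [map_mul, map_natCast, hy', ← mul_assoc, hcN, one_mul]
    · intro y _
      rw [← mul_assoc, hcu, one_mul]
    · intro y _
      rw [← mul_assoc, mul_comm (c : ZMod (N * q))⁻¹, hcu, one_mul]
    · intro y _
      rfl
  have hcard : ((Finset.univ.filter fun y : ZMod (N * q) => π y = x).card : ℚ) = q := by
    have := hfib x (fun _ => 1)
    simpa using this
  simp_rw [bernoulliE_eq]
  rw [Finset.sum_add_distrib, Finset.sum_sub_distrib, ← Finset.mul_sum, hmul, hsum, hsum,
    Finset.sum_const, nsmul_eq_mul, hcard]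
  ring

/-- `∑_{a mod N} E_c(a) F(a)`. -/
def bernoulliSum (p : ℕ) [Fact p.Prime] {R : Type*} [NormedCommRing R] [NormedAlgebra ℚ_[p] R]
    (c N : ℕ) [NeZero N] (F : ℕ → R) : R :=
  ∑ a : ZMod N, ((bernoulliE c N a : ℚ) : ℚ_[p]) • F a.val

theorem bernoulliSum_mul (p : ℕ) [Fact p.Prime] {R : Type*} [NormedCommRing R]
    [NormedAlgebra ℚ_[p] R] (c N q M : ℕ) [NeZero N] [NeZero q] [NeZero M] (hM : M = N * q)
    (hc : c.Coprime M) (F : ℕ → R) (hF : ∀ a b, a ≡ b [MOD N] → F a = F b) :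
    bernoulliSum p c M F = bernoulliSum p c N F := by
  subst hM
  unfold bernoulliSum
  rw [← Finset.sum_fiberwise Finset.univ (ZMod.castHom (Dvd.intro q rfl : N ∣ N * q) (ZMod N))]
  refine Finset.sum_congr rfl fun x _ => ?_
  rw [← sum_bernoulliE c N q hc x, Rat.cast_sum, Finset.sum_smul]
  refine Finset.sum_congr rfl fun y hy => ?_
  congr 1
  apply hF
  have hy' : ZMod.castHom (Dvd.intro q rfl : N ∣ N * q) (ZMod N) y = x :=
    (Finset.mem_filter.1 hy).2
  rw [← ZMod.natCast_eq_natCast_iff, ZMod.natCast_zmod_val, ← hy', ZMod.castHom_apply,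
    ZMod.natCast_val]

/-- The profinite space `(ℤ/d)ˣ × ℤ_pˣ`. -/
abbrev UnitSpace (p d : ℕ) [Fact p.Prime] : Type := (ZMod d)ˣ × ℤ_[p]ˣ

instance instTotallyDisconnectedUnits (p : ℕ) [Fact p.Prime] :
    TotallyDisconnectedSpace ℤ_[p]ˣ := by
  have h : TotallyDisconnectedSpace ℤ_[p] := inferInstance
  rw [← (Units.isOpenEmbedding_val (R := ℤ_[p])).isEmbedding.isTotallyDisconnected_range]
  exact isTotallyDisconnected_of_totallyDisconnectedSpace _

variable {p d : ℕ} [Fact p.Prime] {R : Type*}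

open Classical in
/-- Extension by zero of a function on `(ℤ/d)ˣ × ℤ_pˣ` to `ℤ/d × ℤ_p`. -/
def extendByZero [Zero R] (f : UnitSpace p d → R) (y : ZMod d × ℤ_[p]) : R :=
  if h : IsUnit y.1 ∧ IsUnit y.2 then f (h.1.unit, h.2.unit) else 0

theorem extendByZero_isLocallyConstant [Zero R] (f : LocallyConstant (UnitSpace p d) R)
    (i : ZMod d) : IsLocallyConstant fun z : ℤ_[p] => extendByZero f (i, z) := by
  rw [IsLocallyConstant.iff_eventually_eq]
  intro z
  by_cases hi : IsUnit i
  · by_cases hz : IsUnit z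
    · obtain ⟨u, rfl⟩ := hi
      obtain ⟨v, rfl⟩ := hz
      have h1 : ∀ᶠ w : ℤ_[p]ˣ in 𝓝 v, f (u, w) = f (u, v) := by
        have hc : Continuous fun w : ℤ_[p]ˣ => ((u, w) : UnitSpace p d) := by fun_prop
        exact hc.continuousAt.eventually
          (((IsLocallyConstant.iff_eventually_eq _).1 f.isLocallyConstant) (u, v))
      rw [← (Units.isOpenEmbedding_val (R := ℤ_[p])).map_nhds_eq v, Filter.eventually_map]
      filter_upwards [h1] with w hw
      simpa [extendByZero] using hw
    · have h1 : ∀ᶠ w in 𝓝 z, ‖w - z‖ < 1 := by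
        have := Metric.ball_mem_nhds z one_pos
        filter_upwards [this] with w hw
        rwa [← dist_eq_norm]
      have hz1 : ‖z‖ < 1 := by
        rw [PadicInt.isUnit_iff] at hz
        exact lt_of_le_of_ne (PadicInt.norm_le_one z) hz
      filter_upwards [h1] with w hw
      have hw' : ¬ IsUnit w := by
        rw [PadicInt.isUnit_iff]
        refine ne_of_lt ?_
        have := PadicInt.nonarchimedean (w - z) z
        rw [sub_add_cancel] at this
        exact this.trans_lt (max_lt hw hz1)
      simp [extendByZero, hz, hw']
  · exact Filter.Eventually.of_forall fun w => by simp [extendByZero, hi]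

theorem exists_modEq_extendByZero [NeZero d] [Zero R] (f : LocallyConstant (UnitSpace p d) R) :
    ∃ n₀ : ℕ, ∀ n, n₀ ≤ n → ∀ a b : ℕ, a ≡ b [MOD d * p ^ n] →
      extendByZero f ((a : ZMod d), (a : ℤ_[p])) = extendByZero f ((b : ZMod d), (b : ℤ_[p])) := by
  have key : ∀ i : ZMod d, ∃ n₀ : ℕ, ∀ x y : ℤ_[p], ‖x - y‖ ≤ (p : ℝ) ^ (-(n₀ : ℤ)) →
      extendByZero f (i, x) = extendByZero f (i, y) := by
    intro i
    have hlc := extendByZero_isLocallyConstant f i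
    obtain ⟨δ, hδ, h⟩ := lebesgue_number_lemma_of_metric (s := (Set.univ : Set ℤ_[p]))
      (c := fun r : R => (fun z : ℤ_[p] => extendByZero f (i, z)) ⁻¹' {r}) isCompact_univ
      (fun r => hlc.isOpen_fiber r) (fun x _ => Set.mem_iUnion.2 ⟨_, rfl⟩)
    obtain ⟨n₀, hn₀⟩ := PadicInt.exists_pow_neg_lt p hδ
    refine ⟨n₀, fun x y hxy => ?_⟩
    obtain ⟨r, hr⟩ := h y (Set.mem_univ y)
    have hx : x ∈ Metric.ball y δ := by
      rw [Metric.mem_ball, dist_eq_norm]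
      exact hxy.trans_lt hn₀
    exact (hr hx : _ = r).trans (hr (Metric.mem_ball_self hδ) : _ = r).symm
  choose n₀ hn₀ using key
  refine ⟨Finset.univ.sup n₀, fun n hn a b hab => ?_⟩
  have h1 : (a : ZMod d) = (b : ZMod d) := (ZMod.natCast_eq_natCast_iff _ _ _).2
    (hab.of_dvd (Dvd.intro _ rfl))
  rw [h1]
  refine hn₀ _ _ _ ?_
  have h2 : a ≡ b [MOD p ^ n] := hab.of_dvd (Dvd.intro_left _ rfl)
  have h3 : (a : ℤ_[p]) - b = (((a : ℤ) - b : ℤ) : ℤ_[p]) := by push_cast; ring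
  have h4 : ((p ^ n₀ (b : ZMod d) : ℕ) : ℤ) ∣ (a : ℤ) - b := by
    have h5 := h2.symm.dvd
    refine dvd_trans ?_ h5
    exact_mod_cast pow_dvd_pow p ((Finset.le_sup (Finset.mem_univ _)).trans hn)
  rw [h3, PadicInt.norm_int_le_pow_iff_dvd]
  exact_mod_cast h4

variable [NormedCommRing R]

theorem extendByZero_add (f g : LocallyConstant (UnitSpace p d) R) (y) :
    extendByZero (f + g) y = extendByZero f y + extendByZero g y := by
  unfold extendByZero; split_ifs <;> simp

theorem extendByZero_smul (r : R) (f : LocallyConstant (UnitSpace p d) R) (y) :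
    extendByZero (r • f) y = r * extendByZero f y := by
  unfold extendByZero; split_ifs <;> simp

theorem norm_extendByZero_le [NeZero d] (f : LocallyConstant (UnitSpace p d) R) (y) :
    ‖extendByZero f y‖ ≤ ‖lcIncl (UnitSpace p d) R f‖ := by
  unfold extendByZero
  split_ifs with h
  · exact ContinuousMap.norm_coe_le_norm (lcIncl (UnitSpace p d) R f) _
  · simp

variable [NormedAlgebra ℚ_[p] R]

/-- `n ↦ ∑_{a mod d pⁿ} E_c(a) f(a)`, where `f` is extended by zero; eventually constant. -/
def bernoulliSeq [NeZero d] (c : ℕ) (f : LocallyConstant (UnitSpace p d) R) (n : ℕ) : R :=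
  bernoulliSum p c (d * p ^ n) fun a => extendByZero f ((a : ZMod d), (a : ℤ_[p]))

theorem bernoulliSeq_eventually_const [NeZero d] {c : ℕ} (hcd : c.Coprime d) (hcp : c.Coprime p)
    (f : LocallyConstant (UnitSpace p d) R) :
    ∃ n₀ : ℕ, ∀ n, n₀ ≤ n → bernoulliSeq c f n = bernoulliSeq c f n₀ := by
  obtain ⟨n₀, h⟩ := exists_modEq_extendByZero f
  refine ⟨n₀, fun n hn => ?_⟩
  induction n, hn using Nat.le_induction with
  | base => rfl
  | succ n hn ih =>
    rw [← ih]
    exact bernoulliSum_mul p c (d * p ^ n) p _ (by ring)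
      (Nat.Coprime.mul_right hcd (hcp.pow_right _)) _ (h n hn)

theorem bernoulliSeq_tendsto [NeZero d] {c : ℕ} (hcd : c.Coprime d) (hcp : c.Coprime p)
    (f : LocallyConstant (UnitSpace p d) R) :
    Tendsto (bernoulliSeq c f) atTop (𝓝 (limUnder atTop (bernoulliSeq c f))) := by
  obtain ⟨n₀, h⟩ := bernoulliSeq_eventually_const hcd hcp f
  exact tendsto_nhds_limUnder ⟨_, tendsto_atTop_of_eventually_const h⟩

/-- The Bernoulli measure `E_c` on `(ℤ/d)ˣ × ℤ_pˣ`: a locally constant `f` is sent to the eventual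
value of `∑_{a mod d pⁿ} E_c(a) f(a)`. On the characteristic function of the class of a unit `a`
modulo `d pⁿ` its value is `E_c(a)`, see `bernoulliMeasure_basicClopen`. -/
def bernoulliMeasure [IsUltrametricDist R] [NeZero d] (c : ℕ) (hcd : c.Coprime d)
    (hcp : c.Coprime p) : Measures (UnitSpace p d) R :=
  ⟨{ toFun := fun f => limUnder atTop (bernoulliSeq c f)
     map_add' := fun f g => by
      refine tendsto_nhds_unique (bernoulliSeq_tendsto hcd hcp _) ?_
      refine ((bernoulliSeq_tendsto hcd hcp f).add (bernoulliSeq_tendsto hcd hcp g)).congr ?_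
      intro n
      simp only [bernoulliSeq, bernoulliSum, ← Finset.sum_add_distrib, ← smul_add]
      refine Finset.sum_congr rfl fun a _ => ?_
      congr 1
      exact (extendByZero_add f g _).symm
     map_smul' := fun r f => by
      refine tendsto_nhds_unique (bernoulliSeq_tendsto hcd hcp _) ?_
      refine ((bernoulliSeq_tendsto hcd hcp f).const_mul r).congr ?_
      intro n
      simp only [bernoulliSeq, bernoulliSum, Finset.mul_sum]
      refine Finset.sum_congr rfl fun a _ => ?_
      rw [mul_smul_comm]
      congr 1
      exact (extendByZero_smul r f _).symm },
   by
    refine ⟨1 + ‖(((c : ℚ) - 1) / 2 : ℚ_[p])‖, by positivity, fun f => ?_⟩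
    refine le_of_tendsto (bernoulliSeq_tendsto hcd hcp f).norm (Eventually.of_forall fun n => ?_)
    refine IsUltrametricDist.norm_sum_le_of_forall_le_of_nonneg (by positivity) fun a _ => ?_
    refine (norm_smul_le _ _).trans ?_
    exact mul_le_mul (norm_bernoulliE_le p c _ (Nat.Coprime.mul_right hcd (hcp.pow_right _)) a)
      (norm_extendByZero_le f _) (norm_nonneg _) (by positivity)⟩

end Bern

section Char

variable (p : ℕ) [Fact p.Prime]

/-- The Teichmüller character `ω` modulo `p` with values in `ℤ_p`, extended by zero: the
Teichmüller lift `𝔽_p → W(𝔽_p)` followed by the isomorphism `W(𝔽_p) ≃ ℤ_p`. -/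
def teichmuller : DirichletCharacter ℤ_[p] p where
  toMonoidHom := (WittVector.equiv p).toMonoidHom.comp (WittVector.teichmuller p)
  map_nonunit' := fun a ha => by
    have h : a = 0 := by simpa [isUnit_iff_ne_zero] using ha
    subst h
    simp

theorem continuous_toZModPow (n : ℕ) : Continuous (PadicInt.toZModPow (p := p) n) := by
  refine continuous_of_continuousAt_zero (PadicInt.toZModPow (p := p) n) ?_
  rw [ContinuousAt, map_zero, nhds_discrete (ZMod (p ^ n)), tendsto_pure]
  have hp : (0 : ℝ) < (p : ℝ) ^ (-(n : ℤ)) := by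
    have : (0 : ℝ) < p := by exact_mod_cast (Fact.out : p.Prime).pos
    positivity
  filter_upwards [Metric.closedBall_mem_nhds (0 : ℤ_[p]) hp] with x hx
  rw [mem_closedBall_zero_iff, PadicInt.norm_le_pow_iff_mem_span_pow, ← PadicInt.ker_toZModPow] at hx
  exact hx

theorem continuous_toZMod : Continuous (PadicInt.toZMod (p := p)) := by
  refine continuous_of_continuousAt_zero (PadicInt.toZMod (p := p)) ?_
  rw [ContinuousAt, map_zero, nhds_discrete (ZMod p), tendsto_pure]
  filter_upwards [Metric.ball_mem_nhds (0 : ℤ_[p]) one_pos] with x hx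
  rw [mem_ball_zero_iff, ← PadicInt.mem_nonunits, ← IsLocalRing.mem_maximalIdeal,
    ← PadicInt.ker_toZMod] at hx
  exact hx

/-- `⟨a⟩ = ω⁻¹(a) a`, for `a` a unit (the value is `0` at non-units). -/
def angle : ℤ_[p] →* ℤ_[p] where
  toFun a := (teichmuller p)⁻¹ (PadicInt.toZMod a) * a
  map_one' := by simp
  map_mul' a b := by simp only [map_mul]; ring

theorem continuous_angle : Continuous (angle p) := by
  change Continuous fun a : ℤ_[p] => (teichmuller p)⁻¹ (PadicInt.toZMod a) * a
  exact (continuous_of_discreteTopology.comp (continuous_toZMod p)).mul continuous_id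

variable (R : Type*) [NormedCommRing R] [NormedAlgebra ℚ_[p] R]

/-- The structure map `ℤ_p → R`. -/
def padicIntMap : ℤ_[p] →+* R := (algebraMap ℚ_[p] R).comp PadicInt.Coe.ringHom

theorem continuous_padicIntMap : Continuous (padicIntMap p R) :=
  (continuous_algebraMap ℚ_[p] R).comp continuous_subtype_val

/-- The weight space: continuous monoid homomorphisms `(ℤ/d)ˣ × ℤ_pˣ → R`. -/
abbrev WeightSpace (d : ℕ) : Type _ := UnitSpace p d →ₜ* R

/-- The weight `a ↦ ⟨a⟩ᵏ`. -/
def angleWeight (d k : ℕ) : WeightSpace p R d where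
  toFun a := padicIntMap p R (angle p (a.2 : ℤ_[p])) ^ k
  map_one' := by simp
  map_mul' a b := by simp [mul_pow]
  continuous_toFun := ((continuous_padicIntMap p R).comp ((continuous_angle p).comp
    (Units.continuous_val.comp continuous_snd))).pow k

variable {p R} {d m : ℕ}

/-- The product `χ ω⁻ᵏ` as a character of level `d pᵐ` (the least common multiple of the levels
`d pᵐ` and `p`). Its associated primitive character is `(twist hm χ k).primitiveCharacter`. -/
def twist (hm : 0 < m) (χ : DirichletCharacter R (d * p ^ m)) (k : ℕ) :
    DirichletCharacter R (d * p ^ m) :=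
  χ * DirichletCharacter.changeLevel ((dvd_pow_self p hm.ne').mul_left d)
    ((((teichmuller p).ringHomComp (padicIntMap p R))⁻¹ ^ k : DirichletCharacter R p))

/-- A Dirichlet character modulo `d pᵐ` as a function on `(ℤ/d)ˣ × ℤ_pˣ`. -/
def charExtend (hd : d.Coprime p) (ψ : DirichletCharacter R (d * p ^ m)) : C(UnitSpace p d, R) where
  toFun a := ψ ((ZMod.chineseRemainder (hd.pow_right m)).symm
    ((a.1 : ZMod d), PadicInt.toZModPow m (a.2 : ℤ_[p])))
  continuous_toFun := by
    refine (continuous_of_discreteTopology (f := fun y : ZMod d × ZMod (p ^ m) =>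
      ψ ((ZMod.chineseRemainder (hd.pow_right m)).symm y))).comp ?_
    refine (Units.continuous_val.comp continuous_fst).prodMk ?_
    exact (continuous_toZModPow p m).comp (Units.continuous_val.comp continuous_snd)

/-- The `p`-adic `L`-function `L_p(w, χ) = ∫ χ ω⁻¹(a) w(a) dE_c` on the weight space. -/
def padicLFunction [CompleteSpace R] [IsUltrametricDist R] [NeZero d]
    (hd : d.Coprime p) (hm : 0 < m) (c : ℕ) (hcd : c.Coprime d) (hcp : c.Coprime p)
    (χ : DirichletCharacter R (d * p ^ m)) (w : WeightSpace p R d) : R :=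
  (bernoulliMeasure c hcd hcp).integral (charExtend hd (twist hm χ 1) * (w : C(UnitSpace p d, R)))

/-- The generalized Bernoulli number `B_{k,ψ} = f^{k-1} ∑_{a=1}^{f} ψ(a) B_k(a / f)`, where `f` is
the conductor of `ψ` and `ψ(a)` is the value of the associated primitive character. -/
def generalBernoulli {S : Type*} [CommRing S] [Algebra ℚ S] {N : ℕ} (ψ : DirichletCharacter S N)
    (k : ℕ) : S :=
  algebraMap ℚ S ((ψ.conductor : ℚ) ^ ((k : ℤ) - 1)) *
    ∑ a ∈ Finset.Icc 1 ψ.conductor, ψ.primitiveCharacter (a : ZMod ψ.conductor) *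
      algebraMap ℚ S ((Polynomial.bernoulli k).eval ((a : ℚ) / ψ.conductor))

end Char


section Characterization

variable {p d : ℕ} [Fact p.Prime] {R : Type*}

/-- The class modulo `d pⁿ` of an element of `(ℤ/d)ˣ × ℤ_pˣ`. -/
def classMod (hd : d.Coprime p) (n : ℕ) (x : UnitSpace p d) : ZMod (d * p ^ n) :=
  (ZMod.chineseRemainder (hd.pow_right n)).symm ((x.1 : ZMod d), PadicInt.toZModPow n (x.2 : ℤ_[p]))

theorem continuous_classMod (hd : d.Coprime p) (n : ℕ) : Continuous (classMod hd n) :=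
  (continuous_of_discreteTopology (f := (ZMod.chineseRemainder (hd.pow_right n)).symm)).comp
    ((Units.continuous_val.comp continuous_fst).prodMk
      ((continuous_toZModPow p n).comp (Units.continuous_val.comp continuous_snd)))

open Classical in
/-- The characteristic function of a class modulo `d pⁿ`. -/
def classIndicator (R : Type*) [Zero R] [One R] (hd : d.Coprime p) (n : ℕ) (a : ZMod (d * p ^ n)) :
    LocallyConstant (UnitSpace p d) R :=
  ⟨fun x => if classMod hd n x = a then 1 else 0,
    ((IsLocallyConstant.iff_continuous _).2 (continuous_classMod hd n)).comp
      fun y => if y = a then (1 : R) else 0⟩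

variable [NormedCommRing R] [NormedAlgebra ℚ_[p] R] [IsUltrametricDist R] [NeZero d]

theorem bernoulliMeasure_basicClopen (c : ℕ) (hcd : c.Coprime d) (hcp : c.Coprime p)
    (hd : d.Coprime p) {n : ℕ} (hn : 0 < n) (a : (ZMod (d * p ^ n))ˣ) :
    (bernoulliMeasure (R := R) c hcd hcp).1 (classIndicator R hd n a) =
      algebraMap ℚ_[p] R ((bernoulliE c (d * p ^ n) (a : ZMod (d * p ^ n)) : ℚ) : ℚ_[p]) := by
  set f : LocallyConstant (UnitSpace p d) R := classIndicator R hd n a with hf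
  have hu : ∀ b : ℕ, IsUnit (b : ZMod (d * p^n)) ↔ IsUnit (b : ZMod d) ∧ IsUnit (b : ℤ_[p]) := by
    intro b
    rw [ZMod.isUnit_iff_coprime, ZMod.isUnit_iff_coprime, Nat.coprime_mul_iff_right, Nat.coprime_pow_right_iff hn,
      PadicInt.isUnit_iff, PadicInt.norm_natCast_eq_one_iff, Nat.coprime_comm (m := p)]
  have hcr : ∀ b : ℕ, (ZMod.chineseRemainder (hd.pow_right n)).symm ((b : ZMod d), (b : ZMod (p^n))) = (b : ZMod (d * p ^ n)) := by
    intro b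
    rw [RingEquiv.symm_apply_eq, map_natCast]; rfl
  have hv : ∀ b : ℕ, extendByZero f ((b : ZMod d), (b : ℤ_[p])) = if (b : ZMod (d*p^n)) = a then 1 else 0 := by
    intro b
    unfold extendByZero
    split_ifs with h1 h2 h2
    · simp [hf, classIndicator, classMod, hcr, h2]
    · simp [hf, classIndicator, classMod, hcr, h2]
    · exact absurd ((hu b).1 (h2 ▸ a.isUnit)) h1
    · rfl
  have hs : ∀ k, n ≤ k → bernoulliSeq c f k = algebraMap ℚ_[p] R ((bernoulliE c (d * p^n) (a : ZMod _) : ℚ) : ℚ_[p]) := by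
    intro k hk
    induction k, hk using Nat.le_induction with
    | base =>
      unfold bernoulliSeq bernoulliSum
      simp only [hv]
      rw [Finset.sum_eq_single (a : ZMod _)]
      · simp [Algebra.algebraMap_eq_smul_one]
      · intro b _ hb
        rw [if_neg (by simpa using hb), smul_zero]
      · simp
    | succ k hk ih =>
      rw [← ih]
      refine bernoulliSum_mul p c (d * p ^ k) p _ (by ring)
        (Nat.Coprime.mul_right hcd (hcp.pow_right _)) _ ?_
      intro x y hxy
      rw [hv, hv, (ZMod.natCast_eq_natCast_iff x y (d*p^n)).2 (hxy.of_dvd (mul_dvd_mul_left d (pow_dvd_pow p hk)))]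
  exact (tendsto_atTop_of_eventually_const (i₀ := n) hs).limUnder_eq
end Characterization
end PadicL

end

/-! Write `ψ` for `χ ω⁻ⁿ` modulo `d pᵐ`. On `(ℤ/d)ˣ × ℤ_pˣ` the integrand `χ ω⁻¹(a) ⟨a⟩ⁿ⁻¹` equals
`ψ(a) aⁿ⁻¹`, so the `L`-value is the limit of the Riemann sums `∑ E_c(a) ψ(a) aⁿ⁻¹` over `a` modulo
`N = d pʲ` (`tendsto_bernoulliSum_integral`).

Let `a'` be the representative of `c⁻¹ a`, and write `c a' = a + N t`. Then `E_c(a) = (c - 1)/2 -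
t`, while expanding `(a + N t)ⁿ` to first order gives `-t aⁿ⁻¹ = (aⁿ - (c a')ⁿ) / (n N) + O(N / n)`.
Multiplying by `ψ(a) = ψ(c) ψ(a')` and summing, the Riemann sum is, up to `O(N / n)`, `(c - 1)/2 · ∑
ψ(a) aⁿ⁻¹ + (1 - ψ(c) cⁿ) · n⁻¹ · N⁻¹ ∑ ψ(a) aⁿ` (`norm_bernoulliSum_sub_le`).

The normalized power sums converge because `M⁻¹ ∑_{k < M} (x + k)ⁿ` is a difference quotient of
`B_{n+1} / (n + 1)`, with derivative `B_n`, and `M → 0` in `ℚ_p`. The unnormalized sums therefore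
tend to `0`. Since `d` divides the conductor of `ψ`, the character `ψ` differs from its primitive
version only at multiples of `p`; removing those yields the Euler factor
(`tendsto_sum_character_mul_pow`). Finally `ψ(c) cⁿ = χ(c) ⟨c⟩ⁿ`. -/

namespace PadicL

open Filter Topology

/-! ### Power sums and Bernoulli polynomials as `p`-adic limits -/

section PowerSums

/-- Telescoping of `B_{n+1}(1 + y) - B_{n+1}(y) = (n + 1) yⁿ`. -/
theorem sum_range_add_pow_eq_bernoulli_sub (x : ℚ) (n M : ℕ) :
    ((n : ℚ) + 1) * ∑ k ∈ Finset.range M, (x + k) ^ n =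
      (Polynomial.bernoulli (n + 1)).eval (x + M) - (Polynomial.bernoulli (n + 1)).eval x := by
  induction M with
  | zero => simp
  | succ M ih =>
    have h := Polynomial.bernoulli_eval_one_add (n + 1) (x + M)
    rw [Finset.sum_range_succ, mul_add, ih, Nat.cast_succ,
      show x + ((M : ℚ) + 1) = 1 + (x + M) by ring, h]
    push_cast
    ring

theorem sum_range_mul_eq {A : Type*} [AddCommMonoid A] (g : ℕ → A) (f M : ℕ) :
    ∑ a ∈ Finset.range (f * M), g a =
      ∑ r ∈ Finset.range f, ∑ k ∈ Finset.range M, g (r + f * k) := by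
  rw [Finset.sum_comm]
  induction M with
  | zero => simp
  | succ M ih =>
    rw [Nat.mul_succ, Finset.sum_range_add, Finset.sum_range_succ, ih]
    simp_rw [add_comm]

variable {p : ℕ} [Fact p.Prime]

theorem tendsto_natCast_mul_pow (M : ℕ) :
    Tendsto (fun i : ℕ => ((M * p ^ i : ℕ) : ℚ_[p])) atTop (𝓝 0) := by
  have h : Tendsto (fun i : ℕ => (p : ℚ_[p]) ^ i) atTop (𝓝 0) :=
    tendsto_pow_atTop_nhds_zero_of_norm_lt_one Padic.norm_p_lt_one
  simpa using h.const_mul (M : ℚ_[p])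

/-- By telescoping, the left side is the difference quotient of `B_{n+1} / (n + 1)` at `x` with
increment `M j`, and `B_{n+1}' = (n + 1) B_n`. -/
theorem tendsto_sum_range_add_pow (x : ℚ) (n : ℕ) {M : ℕ → ℕ} (hM0 : ∀ j, M j ≠ 0)
    (hM : Tendsto (fun j => (M j : ℚ_[p])) atTop (𝓝 0)) :
    Tendsto (fun j => (M j : ℚ_[p])⁻¹ * ∑ k ∈ Finset.range (M j), ((x : ℚ_[p]) + k) ^ n) atTop
      (𝓝 (((Polynomial.bernoulli n).eval x : ℚ) : ℚ_[p])) := by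
  have hcast : ∀ (P : Polynomial ℚ) (y : ℚ),
      (P.map (algebraMap ℚ ℚ_[p])).eval (y : ℚ_[p]) = ((P.eval y : ℚ) : ℚ_[p]) := by
    intro P y
    rw [← eq_ratCast (algebraMap ℚ ℚ_[p]) y, Polynomial.eval_map_algebraMap,
      Polynomial.aeval_algebraMap_apply, eq_ratCast, Polynomial.coe_aeval_eq_eval]
  have hn : ((n : ℚ_[p]) + 1) ≠ 0 := by exact_mod_cast n.succ_ne_zero
  have hd := hasDerivAt_iff_tendsto_slope_zero.1
    (((Polynomial.bernoulli (n + 1)).map (algebraMap ℚ ℚ_[p])).hasDerivAt (x : ℚ_[p]))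
  have hM' : Tendsto (fun j => (M j : ℚ_[p])) atTop (𝓝[≠] 0) :=
    tendsto_nhdsWithin_iff.2 ⟨hM, Eventually.of_forall fun j => by
      simpa using hM0 j⟩
  have h := (hd.comp hM').const_mul ((n : ℚ_[p]) + 1)⁻¹
  rw [Polynomial.derivative_map, Polynomial.derivative_bernoulli_add_one, hcast, hcast] at h
  have hlim : ((n : ℚ_[p]) + 1)⁻¹ *
      ((((n : Polynomial ℚ) + 1) * Polynomial.bernoulli n).eval x : ℚ) =
      (((Polynomial.bernoulli n).eval x : ℚ) : ℚ_[p]) := by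
    simp only [Polynomial.eval_mul, Polynomial.eval_add, Polynomial.eval_natCast,
      Polynomial.eval_one]
    push_cast
    rw [inv_mul_cancel_left₀ hn]
  rw [hlim] at h
  refine h.congr fun j => ?_
  have hs := congrArg (fun q : ℚ => (q : ℚ_[p])) (sum_range_add_pow_eq_bernoulli_sub x n (M j))
  simp only [Rat.cast_sub, ← hcast] at hs
  push_cast at hs
  simp only [Function.comp_apply, smul_eq_mul]
  rw [← hcast (Polynomial.bernoulli (n + 1)) x, ← hs]
  field_simp

variable {R : Type*} [NormedCommRing R] [NormedAlgebra ℚ_[p] R]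

/-- The normalized power sums of a function periodic modulo `f`, over longer and longer ranges,
tend to the corresponding generalized Bernoulli number. -/
theorem tendsto_sum_range_periodic {f : ℕ} (hf : f ≠ 0) (θ : ℕ → R)
    (hθ : ∀ r k, θ (r + f * k) = θ r) (n : ℕ) {M : ℕ → ℕ} (hM0 : ∀ j, M j ≠ 0)
    (hM : Tendsto (fun j => (M j : ℚ_[p])) atTop (𝓝 0)) :
    Tendsto (fun j => ((f * M j : ℕ) : ℚ_[p])⁻¹ •
        ∑ a ∈ Finset.range (f * M j), θ a * (a : R) ^ n) atTop
      (𝓝 (((f : ℚ_[p]) ^ ((n : ℤ) - 1)) • ∑ r ∈ Finset.range f,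
        (((Polynomial.bernoulli n).eval ((r : ℚ) / f) : ℚ) : ℚ_[p]) • θ r)) := by
  have hfp : (f : ℚ_[p]) ≠ 0 := by exact_mod_cast hf
  have h : Tendsto (fun j => ((f : ℚ_[p]) ^ ((n : ℤ) - 1)) • ∑ r ∈ Finset.range f,
      ((M j : ℚ_[p])⁻¹ * ∑ k ∈ Finset.range (M j), ((((r : ℚ) / f : ℚ) : ℚ_[p]) + k) ^ n) • θ r)
      atTop (𝓝 (((f : ℚ_[p]) ^ ((n : ℤ) - 1)) • ∑ r ∈ Finset.range f,
        (((Polynomial.bernoulli n).eval ((r : ℚ) / f) : ℚ) : ℚ_[p]) • θ r)) :=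
    (tendsto_finsetSum _ fun (r : ℕ) _ =>
      (tendsto_sum_range_add_pow ((r : ℚ) / f) n hM0 hM).smul_const (θ r)).const_smul _
  refine h.congr fun j => ?_
  have hMj : (M j : ℚ_[p]) ≠ 0 := by exact_mod_cast hM0 j
  rw [sum_range_mul_eq, Finset.smul_sum, Finset.smul_sum]
  refine Finset.sum_congr rfl fun r _ => ?_
  -- From `r + f k = f (r / f + k)`: the factor `fⁿ` and the normalization `(f M)⁻¹` combine to
  -- `fⁿ⁻¹ M⁻¹`.
  have hterm : ∀ k : ℕ, θ (r + f * k) * ((r + f * k : ℕ) : R) ^ n =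
      (((f : ℚ_[p]) ^ n) * ((((r : ℚ) / f : ℚ) : ℚ_[p]) + k) ^ n) • θ r := by
    intro k
    have h1 : ((f : ℚ_[p]) ^ n) * ((((r : ℚ) / f : ℚ) : ℚ_[p]) + k) ^ n =
        (r + f * k : ℕ) ^ n := by
      rw [← mul_pow]
      push_cast
      field_simp
    rw [hθ, h1, Algebra.smul_def, map_pow, map_natCast, mul_comm]
  simp_rw [hterm]
  rw [← Finset.sum_smul, smul_smul, smul_smul, ← Finset.mul_sum, zpow_sub₀ hfp, zpow_natCast,
    zpow_one]
  congr 1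
  push_cast
  field_simp

/-- The sum is `f M j`, which tends to `0`, times the convergent normalized sum. -/
theorem tendsto_sum_range_periodic_zero {f : ℕ} (hf : f ≠ 0) (θ : ℕ → R)
    (hθ : ∀ r k, θ (r + f * k) = θ r) (n : ℕ) {M : ℕ → ℕ} (hM0 : ∀ j, M j ≠ 0)
    (hM : Tendsto (fun j => (M j : ℚ_[p])) atTop (𝓝 0)) :
    Tendsto (fun j => ∑ a ∈ Finset.range (f * M j), θ a * (a : R) ^ n) atTop (𝓝 0) := by
  have h1 : Tendsto (fun j => ((f * M j : ℕ) : ℚ_[p])) atTop (𝓝 0) := by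
    simpa using hM.const_mul (f : ℚ_[p])
  have h := h1.smul (tendsto_sum_range_periodic hf θ hθ n hM0 hM)
  rw [zero_smul] at h
  refine h.congr fun j => ?_
  rw [smul_inv_smul₀]
  exact_mod_cast Nat.mul_ne_zero hf (hM0 j)

end PowerSums

/-! ### Riemann sums of the Bernoulli measure modulo `N` -/

section Congruence

theorem sum_zmod_val {A : Type*} [AddCommMonoid A] (N : ℕ) [NeZero N] (g : ℕ → A) :
    ∑ a : ZMod N, g a.val = ∑ a ∈ Finset.range N, g a := by
  refine Finset.sum_nbij' (fun a => a.val) (fun a => (a : ZMod N)) ?_ ?_ ?_ ?_ ?_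
  · exact fun a _ => Finset.mem_range.2 (ZMod.val_lt a)
  · exact fun a _ => Finset.mem_univ _
  · exact fun a _ => ZMod.natCast_zmod_val a
  · exact fun a ha => ZMod.val_cast_of_lt (Finset.mem_range.1 ha)
  · exact fun a _ => rfl

/-- With `c a' = a + N t` one has `E_c(a) = (c - 1)/2 - t`; the linear term in the binomial
expansion of `(c a')ⁿ` is `n aⁿ⁻¹ N t`, so `t aⁿ⁻¹` can be read off from `aⁿ - (c a')ⁿ`. -/
theorem exists_bernoulliE_mul_pow (c N : ℕ) [NeZero N] (hc : c.Coprime N) (a : ZMod N) (n : ℕ)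
    (hn : n ≠ 0) :
    ∃ D : ℤ, bernoulliE c N a * (a.val : ℚ) ^ (n - 1) =
      ((c : ℚ) - 1) / 2 * (a.val : ℚ) ^ (n - 1) + (n : ℚ)⁻¹ * ((N : ℚ)⁻¹ * ((a.val : ℚ) ^ n -
        (c * (((c : ZMod N)⁻¹ * a).val : ℚ)) ^ n)) + (N : ℚ) / n * D := by
  have hN : (N : ℚ) ≠ 0 := by exact_mod_cast NeZero.ne N
  have hn' : (n : ℚ) ≠ 0 := by exact_mod_cast hn
  have hz : ((c * (((c : ZMod N)⁻¹ * a).val : ℤ) - (a.val : ℤ) : ℤ) : ZMod N) = 0 := by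
    push_cast
    rw [ZMod.natCast_zmod_val, ZMod.natCast_zmod_val, ← mul_assoc, ZMod.coe_mul_inv_eq_one _ hc,
      one_mul, sub_self]
  rw [ZMod.intCast_zmod_eq_zero_iff_dvd] at hz
  obtain ⟨t, ht⟩ := hz
  obtain ⟨k, hk⟩ := Polynomial.powAddExpansion (a.val : ℤ) (N * t) n
  rw [← ht, add_sub_cancel, ht] at hk
  have ht' : (c : ℚ) * (((c : ZMod N)⁻¹ * a).val : ℚ) = (a.val : ℚ) + N * t := by
    have : (c : ℤ) * (((c : ZMod N)⁻¹ * a).val : ℤ) = (a.val : ℤ) + N * t := by linarith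
    exact_mod_cast this
  have hk' : ((c : ℚ) * (((c : ZMod N)⁻¹ * a).val : ℚ)) ^ n = (a.val : ℚ) ^ n +
      n * (a.val : ℚ) ^ (n - 1) * (N * t) + k * (N * t) ^ 2 := by
    exact_mod_cast hk
  -- The quadratic remainder `k (N t)²`, divided by `n N`, is `(N / n) k t²`.
  refine ⟨k * t ^ 2, ?_⟩
  rw [hk', bernoulliE_eq, ← mul_div_assoc, ht']
  push_cast
  field_simp
  ring

variable {p : ℕ} [Fact p.Prime] {R : Type*} [NormedCommRing R] [IsUltrametricDist R]
  [NormedAlgebra ℚ_[p] R]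

/-- The Riemann sums of `F(a) aⁿ⁻¹` for the Bernoulli measure in terms of power sums. -/
theorem norm_bernoulliSum_sub_le (c N : ℕ) [NeZero N] (hc : c.Coprime N) (F : ZMod N →* R) {C : ℝ}
    (hC : ∀ a, ‖F a‖ ≤ C) (n : ℕ) (hn : n ≠ 0) :
    ‖bernoulliSum p c N (fun a => F a * (a : R) ^ (n - 1)) -
      ((((c : ℚ_[p]) - 1) / 2) • ∑ a ∈ Finset.range N, F a * (a : R) ^ (n - 1) +
        (1 - F c * (c : R) ^ n) * ((n : ℚ_[p])⁻¹ • ((N : ℚ_[p])⁻¹ •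
          ∑ a ∈ Finset.range N, F a * (a : R) ^ n)))‖ ≤ ‖(N : ℚ_[p]) / n‖ * C := by
  have hcu : (c : ZMod N) * (c : ZMod N)⁻¹ = 1 := ZMod.coe_mul_inv_eq_one _ hc
  choose D hD using fun a => exists_bernoulliE_mul_pow c N hc a n hn
  have hterm : ∀ a : ZMod N, ((bernoulliE c N a : ℚ) : ℚ_[p]) •
      (F (a.val : ZMod N) * (a.val : R) ^ (n - 1)) =
      (((c : ℚ_[p]) - 1) / 2) • (F (a.val : ZMod N) * (a.val : R) ^ (n - 1)) +
      (n : ℚ_[p])⁻¹ • ((N : ℚ_[p])⁻¹ • (F (a.val : ZMod N) * (a.val : R) ^ n -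
        F c * (c : R) ^ n * (F ((c : ZMod N)⁻¹ * a) * (((c : ZMod N)⁻¹ * a).val : R) ^ n))) +
      ((N : ℚ_[p]) / n * D a) • F a := by
    intro a
    have h := congrArg (fun q : ℚ => algebraMap ℚ_[p] R (q : ℚ_[p])) (hD a)
    push_cast at h
    -- This turns `F(a) (c a')ⁿ` into the constant `F(c) cⁿ` times `F(a') a'ⁿ`, a term of the same
    -- power sum at `a' = c⁻¹ a`.
    have hF : F a = F c * F ((c : ZMod N)⁻¹ * a) := by
      rw [← map_mul, ← mul_assoc, hcu, one_mul]
    simp only [Algebra.smul_def, map_mul (algebraMap ℚ_[p] R), ZMod.natCast_zmod_val]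
    calc _ = algebraMap ℚ_[p] R (bernoulliE c N a : ℚ) * (a.val : R) ^ (n - 1) * F a := by ring
      _ = _ := by
        rw [h]
        linear_combination (-(algebraMap ℚ_[p] R (n : ℚ_[p])⁻¹ * algebraMap ℚ_[p] R (N : ℚ_[p])⁻¹ *
          ((c : R) * (((c : ZMod N)⁻¹ * a).val : R)) ^ n)) * hF
  have hre : ∑ a : ZMod N, F ((c : ZMod N)⁻¹ * a) * (((c : ZMod N)⁻¹ * a).val : R) ^ n =
      ∑ a : ZMod N, F (a.val : ZMod N) * (a.val : R) ^ n := by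
    refine Finset.sum_nbij' (fun a => (c : ZMod N)⁻¹ * a) (fun a => (c : ZMod N) * a)
      (fun _ _ => Finset.mem_univ _) (fun _ _ => Finset.mem_univ _) ?_ ?_ ?_
    · intro a _
      rw [← mul_assoc, hcu, one_mul]
    · intro a _
      rw [← mul_assoc, mul_comm (c : ZMod N)⁻¹, hcu, one_mul]
    · intro a _
      rw [ZMod.natCast_zmod_val]
  have hsum : bernoulliSum p c N (fun a => F a * (a : R) ^ (n - 1)) =
      (((c : ℚ_[p]) - 1) / 2) • ∑ a ∈ Finset.range N, F a * (a : R) ^ (n - 1) +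
        (1 - F c * (c : R) ^ n) * ((n : ℚ_[p])⁻¹ • ((N : ℚ_[p])⁻¹ •
          ∑ a ∈ Finset.range N, F a * (a : R) ^ n)) +
      ∑ a : ZMod N, ((N : ℚ_[p]) / n * D a) • F a := by
    rw [← sum_zmod_val N (fun a => F a * (a : R) ^ (n - 1)),
      ← sum_zmod_val N (fun a => F a * (a : R) ^ n)]
    unfold bernoulliSum
    simp_rw [hterm]
    rw [Finset.sum_add_distrib, Finset.sum_add_distrib, ← Finset.smul_sum, ← Finset.smul_sum,
      ← Finset.smul_sum, Finset.sum_sub_distrib, ← Finset.mul_sum, hre, sub_mul, one_mul,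
      smul_sub, smul_sub, mul_smul_comm, mul_smul_comm]
  have hC0 : 0 ≤ C := (norm_nonneg _).trans (hC 1)
  rw [hsum, add_sub_cancel_left]
  -- The ultrametric inequality makes the bound independent of the number `N` of error terms; each
  -- `D a` is an integer, of norm at most `1`.
  refine IsUltrametricDist.norm_sum_le_of_forall_le_of_nonneg (by positivity) fun a _ => ?_
  refine (norm_smul_le _ _).trans ?_
  refine mul_le_mul ?_ (hC a) (norm_nonneg _) (norm_nonneg _)
  rw [norm_mul]
  exact mul_le_of_le_one_right (norm_nonneg _) (Padic.norm_int_le_one _)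

end Congruence

/-! ### The integral as a limit of Riemann sums -/

section Riemann

variable {p d : ℕ} [Fact p.Prime] (hd : d.Coprime p)

theorem natCast_val_classMod_prod [NeZero d] (n : ℕ) (x : UnitSpace p d) :
    ((classMod hd n x).val : ZMod d) = x.1 ∧
      ((classMod hd n x).val : ZMod (p ^ n)) = PadicInt.toZModPow n (x.2 : ℤ_[p]) := by
  have h : ZMod.chineseRemainder (hd.pow_right n) ((classMod hd n x).val : ZMod (d * p ^ n)) =
      ((x.1 : ZMod d), PadicInt.toZModPow n (x.2 : ℤ_[p])) := by
    rw [ZMod.natCast_zmod_val, classMod, RingEquiv.apply_symm_apply]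
  rw [map_natCast] at h
  exact ⟨congrArg Prod.fst h, congrArg Prod.snd h⟩

theorem sub_val_classMod_mem [NeZero d] (n : ℕ) (x : UnitSpace p d) :
    (x.2 : ℤ_[p]) - (classMod hd n x).val ∈ Ideal.span {(p : ℤ_[p]) ^ n} := by
  rw [← PadicInt.ker_toZModPow, RingHom.mem_ker, map_sub, map_natCast,
    (natCast_val_classMod_prod hd n x).2, sub_self]

theorem natCast_val_classMod [NeZero d] {m n : ℕ} (hmn : m ≤ n) (x : UnitSpace p d) :
    ((classMod hd n x).val : ZMod (d * p ^ m)) = classMod hd m x := by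
  refine (ZMod.chineseRemainder (hd.pow_right m)).injective ?_
  have h0 : ZMod.chineseRemainder (hd.pow_right m) (classMod hd m x) =
      ((x.1 : ZMod d), PadicInt.toZModPow m (x.2 : ℤ_[p])) := RingEquiv.apply_symm_apply _ _
  rw [h0, map_natCast]
  refine Prod.ext (natCast_val_classMod_prod hd n x).1 ?_
  change (((classMod hd n x).val : ℕ) : ZMod (p ^ m)) = PadicInt.toZModPow m (x.2 : ℤ_[p])
  have h : (x.2 : ℤ_[p]) - (classMod hd n x).val ∈ Ideal.span {(p : ℤ_[p]) ^ m} :=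
    Ideal.span_singleton_le_span_singleton.2 (pow_dvd_pow _ hmn) (sub_val_classMod_mem hd n x)
  rw [← PadicInt.ker_toZModPow, RingHom.mem_ker, map_sub, map_natCast, sub_eq_zero] at h
  exact h.symm

theorem castHom_classMod [NeZero d] {m : ℕ} (hm : 0 < m) (x : UnitSpace p d) :
    ZMod.castHom ((dvd_pow_self p hm.ne').mul_left d) (ZMod p) (classMod hd m x) =
      PadicInt.toZMod (x.2 : ℤ_[p]) := by
  have h : (x.2 : ℤ_[p]) - (classMod hd m x).val ∈ IsLocalRing.maximalIdeal ℤ_[p] := by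
    rw [PadicInt.maximalIdeal_eq_span_p]
    exact Ideal.span_singleton_le_span_singleton.2 (dvd_pow_self _ hm.ne')
      (sub_val_classMod_mem hd m x)
  rw [← PadicInt.ker_toZMod, RingHom.mem_ker, map_sub, map_natCast, sub_eq_zero] at h
  rw [h, ← map_natCast (ZMod.castHom ((dvd_pow_self p hm.ne').mul_left d) (ZMod p)),
    ZMod.natCast_zmod_val]

variable {R : Type*} [NormedCommRing R] [NormedAlgebra ℚ_[p] R]

theorem norm_padicIntMap (x : ℤ_[p]) : ‖padicIntMap p R x‖ = ‖x‖ * ‖(1 : R)‖ :=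
  norm_algebraMap R (x : ℚ_[p])

variable [NeZero d]

/-- The Bernoulli measure of a function factoring through the classes modulo `d pⁿ`. -/
theorem bernoulliMeasure_of_factorsThrough [IsUltrametricDist R] (c : ℕ) (hcd : c.Coprime d) (hcp : c.Coprime p) {n : ℕ}
    (hn : 0 < n) (g : LocallyConstant (UnitSpace p d) R) (h : ZMod (d * p ^ n) → R)
    (hg : ∀ x, g x = h (classMod hd n x)) (h0 : ∀ a, ¬ IsUnit a → h a = 0) :
    (bernoulliMeasure (R := R) c hcd hcp).1 g =
      ∑ a, ((bernoulliE c (d * p ^ n) a : ℚ) : ℚ_[p]) • h a := by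
  classical
  have hgs : g = ∑ a, h a • classIndicator R hd n a := by
    ext x
    rw [← LocallyConstant.coeFnAddMonoidHom_apply (∑ a, _), map_sum, Finset.sum_apply, hg]
    simp [classIndicator]
  rw [hgs, map_sum]
  refine Finset.sum_congr rfl fun a _ => ?_
  by_cases ha : IsUnit a
  · obtain ⟨u, rfl⟩ := ha
    rw [map_smul, bernoulliMeasure_basicClopen c hcd hcp hd hn u, smul_eq_mul, mul_comm,
      Algebra.smul_def]
  · rw [h0 a ha, zero_smul, map_zero, smul_zero]

/-- The function `ψ(a) aᵏ` on `(ℤ/d)ˣ × ℤ_pˣ`. -/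
noncomputable def charMulPow {m : ℕ} (ψ : DirichletCharacter R (d * p ^ m)) (k : ℕ) : C(UnitSpace p d, R) :=
  charExtend hd ψ * ⟨fun x => padicIntMap p R (x.2 : ℤ_[p]) ^ k, ((continuous_padicIntMap p R).comp
    (Units.continuous_val.comp continuous_snd)).pow k⟩

/-- The locally constant approximation modulo `d pʲ` of `charMulPow`. -/
noncomputable def charMulPowApprox {m : ℕ} (ψ : DirichletCharacter R (d * p ^ m)) (k j : ℕ) :
    LocallyConstant (UnitSpace p d) R :=
  ⟨fun x => ψ ((classMod hd j x).val : ℕ) * ((classMod hd j x).val : R) ^ k,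
    ((IsLocallyConstant.iff_continuous _).2 (continuous_classMod hd j)).comp
      fun a => ψ (a.val : ℕ) * (a.val : R) ^ k⟩

/-- At level `m + i ≥ m` the factor `ψ` is reproduced exactly, and `x ≡ v` modulo `p ^ (m + i)`
implies `xᵏ ≡ vᵏ`, so the error is uniformly small in `x`. The factor `‖(1 : R)‖` stays because the
norm of `1` is not assumed to be `1`. -/
theorem tendsto_charMulPowApprox {m : ℕ} (ψ : DirichletCharacter R (d * p ^ m)) (k : ℕ) :
    Tendsto (fun i => lcIncl (UnitSpace p d) R (charMulPowApprox hd ψ k (m + i))) atTop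
      (𝓝 (charMulPow hd ψ k)) := by
  obtain ⟨C, hC⟩ := (Set.finite_range fun a => ‖ψ a‖).bddAbove
  have hC' : ∀ a, ‖ψ a‖ ≤ C := fun a => hC ⟨a, rfl⟩
  have hC0 : 0 ≤ C := (norm_nonneg _).trans (hC' 1)
  have hp1 : (1 : ℝ) < p := by exact_mod_cast (Fact.out : p.Prime).one_lt
  have hlim : Tendsto (fun i : ℕ => C * ((((p : ℝ)⁻¹) ^ i) * ‖(1 : R)‖)) atTop (𝓝 0) := by
    have := (tendsto_pow_atTop_nhds_zero_of_lt_one (inv_nonneg.2 (by positivity : (0 : ℝ) ≤ p))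
      (inv_lt_one_of_one_lt₀ hp1)).mul_const ‖(1 : R)‖ |>.const_mul C
    simpa using this
  rw [tendsto_iff_dist_tendsto_zero]
  refine squeeze_zero (fun _ => dist_nonneg) (fun i => ?_) hlim
  rw [ContinuousMap.dist_le (by positivity)]
  intro x
  set v := (classMod hd (m + i) x).val with hv
  have h1 : lcIncl (UnitSpace p d) R (charMulPowApprox hd ψ k (m + i)) x =
      ψ (classMod hd m x) * padicIntMap p R ((v : ℤ_[p]) ^ k) := by
    change ψ ((classMod hd (m + i) x).val : ℕ) * ((classMod hd (m + i) x).val : R) ^ k = _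
    rw [natCast_val_classMod hd (Nat.le_add_right m i), map_pow, map_natCast]
  have h2 : charMulPow hd ψ k x = ψ (classMod hd m x) * padicIntMap p R ((x.2 : ℤ_[p]) ^ k) := by
    rw [map_pow]; rfl
  rw [h1, h2, dist_comm, dist_eq_norm, ← mul_sub, ← map_sub]
  refine (norm_mul_le _ _).trans (mul_le_mul (hC' _) ?_ (norm_nonneg _) hC0)
  rw [norm_padicIntMap]
  refine mul_le_mul_of_nonneg_right ?_ (norm_nonneg _)
  have h3 : (x.2 : ℤ_[p]) ^ k - (v : ℤ_[p]) ^ k ∈ Ideal.span {(p : ℤ_[p]) ^ i} := by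
    refine Ideal.span_singleton_le_span_singleton.2 (pow_dvd_pow _ (Nat.le_add_left i m))
      (Ideal.mem_of_dvd _ (sub_dvd_pow_sub_pow _ _ k) (sub_val_classMod_mem hd (m + i) x))
  rwa [← PadicInt.norm_le_pow_iff_mem_span_pow, zpow_neg, zpow_natCast, ← inv_pow] at h3

variable [CompleteSpace R] [IsUltrametricDist R]

theorem tendsto_bernoulliSum_integral (c : ℕ) (hcd : c.Coprime d) (hcp : c.Coprime p) {m : ℕ}
    (hm : 0 < m) (ψ : DirichletCharacter R (d * p ^ m)) (k : ℕ) :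
    Tendsto (fun i => bernoulliSum p c (d * p ^ (m + i)) fun a => ψ (a : ℕ) * (a : R) ^ k) atTop
      (𝓝 ((bernoulliMeasure (R := R) c hcd hcp).integral (charMulPow hd ψ k))) := by
  refine (((bernoulliMeasure (R := R) c hcd hcp).integral.continuous.tendsto _).comp
    (tendsto_charMulPowApprox hd ψ k)).congr fun i => ?_
  rw [Function.comp_apply, Measures.integral_coe]
  refine bernoulliMeasure_of_factorsThrough hd c hcd hcp (n := m + i) (by omega) _
    (fun a => ψ (a.val : ℕ) * (a.val : R) ^ k) (fun _ => rfl) fun a ha => ?_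
  -- Since `m > 0`, being a unit modulo `d pᵐ` or modulo `d pᵐ⁺ⁱ` means the same: prime to `d` and
  -- to `p`.
  rw [ψ.map_nonunit, zero_mul]
  rw [ZMod.isUnit_iff_coprime, Nat.coprime_mul_iff_right, Nat.coprime_pow_right_iff hm]
  rwa [← ZMod.natCast_zmod_val a, ZMod.isUnit_iff_coprime, Nat.coprime_mul_iff_right,
    Nat.coprime_pow_right_iff (by omega)] at ha

end Riemann

/-! ### Twists by powers of the Teichmüller character -/

section Twist

variable {p d m : ℕ} [Fact p.Prime] {R : Type*} [NormedCommRing R] [NormedAlgebra ℚ_[p] R]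

/-- Valid at non-units too, even for `k = 0`, because `χ` vanishes there. -/
theorem twist_apply (hm : 0 < m) (χ : DirichletCharacter R (d * p ^ m)) (k : ℕ)
    (y : ZMod (d * p ^ m)) :
    twist hm χ k y = χ y * padicIntMap p R ((teichmuller p)⁻¹
      (ZMod.castHom ((dvd_pow_self p hm.ne').mul_left d) (ZMod p) y)) ^ k := by
  rw [twist, MulChar.mul_apply]
  by_cases hy : IsUnit y
  · obtain ⟨u, rfl⟩ := hy
    rw [DirichletCharacter.changeLevel_eq_cast_of_dvd]
    congr 1
    have hu : IsUnit (ZMod.castHom ((dvd_pow_self p hm.ne').mul_left d) (ZMod p) (u : ZMod _)) :=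
      u.isUnit.map _
    change _ = padicIntMap p R ((teichmuller p)⁻¹ ((u : ZMod (d * p ^ m)).cast : ZMod p)) ^ k
    obtain ⟨v, hv⟩ := hu
    rw [ZMod.castHom_apply] at hv
    rw [← hv, MulChar.pow_apply_coe, MulChar.inv_apply', MulChar.inv_apply',
      MulChar.ringHomComp_apply]
  · rw [χ.map_nonunit hy, zero_mul, zero_mul]

/-- Each of the `l` extra factors `ω⁻¹` is paired with one factor `x` to form `⟨x⟩`. The case `k =
1`, `l = n - 1` rewrites the integrand, and `k = 0`, `l = n` rewrites the factor at `c`. -/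
theorem twist_mul_pow (hm : 0 < m) (χ : DirichletCharacter R (d * p ^ m)) (k : ℕ)
    (y : ZMod (d * p ^ m)) (x : ℤ_[p])
    (hyx : ZMod.castHom ((dvd_pow_self p hm.ne').mul_left d) (ZMod p) y = PadicInt.toZMod x)
    (l : ℕ) :
    twist hm χ (k + l) y * padicIntMap p R x ^ l =
      twist hm χ k y * padicIntMap p R (angle p x) ^ l := by
  have h : angle p x = (teichmuller p)⁻¹ (PadicInt.toZMod x) * x := rfl
  rw [twist_apply, twist_apply, hyx, h, map_mul, mul_pow, pow_add]
  ring

theorem twist_zero (hm : 0 < m) (χ : DirichletCharacter R (d * p ^ m)) : twist hm χ 0 = χ := by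
  rw [twist, pow_zero, map_one, mul_one]

theorem twist_natCast_mul_pow (hm : 0 < m) (χ : DirichletCharacter R (d * p ^ m)) (c n : ℕ) :
    twist hm χ n (c : ZMod (d * p ^ m)) * (c : R) ^ n =
      χ (c : ZMod (d * p ^ m)) * padicIntMap p R (angle p (c : ℤ_[p])) ^ n := by
  have h := twist_mul_pow hm χ 0 (c : ZMod (d * p ^ m)) (c : ℤ_[p])
    (by rw [map_natCast, map_natCast]) n
  rwa [zero_add, twist_zero, map_natCast (padicIntMap p R)] at h

theorem charExtend_twist_mul_angleWeight [NeZero d] (hd : d.Coprime p) (hm : 0 < m)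
    (χ : DirichletCharacter R (d * p ^ m)) {n : ℕ} (hn : 0 < n) :
    charExtend hd (twist hm χ 1) * (angleWeight p R d (n - 1) : C(UnitSpace p d, R)) =
      charMulPow hd (twist hm χ n) (n - 1) := by
  ext x
  have h := twist_mul_pow hm χ 1 (classMod hd m x) (x.2 : ℤ_[p]) (castHom_classMod hd hm x) (n - 1)
  rw [Nat.add_sub_cancel' hn] at h
  exact h.symm

/-- Untwisting recovers `χ` from the twist and a character of conductor dividing `p`, so `d` divides
`p` times the conductor of the twist, and `d` is prime to `p`. -/
theorem dvd_conductor_twist [NeZero d] (hd : d.Coprime p) (hm : 0 < m)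
    (χ : DirichletCharacter R (d * p ^ m)) (hcond : d ∣ χ.conductor) (k : ℕ) :
    d ∣ (twist hm χ k).conductor := by
  set τ : DirichletCharacter R (d * p ^ m) := DirichletCharacter.changeLevel
    ((dvd_pow_self p hm.ne').mul_left d)
    ((((teichmuller p).ringHomComp (padicIntMap p R))⁻¹ ^ k : DirichletCharacter R p)) with hτ
  have hχ : χ = twist hm χ k * τ⁻¹ := by
    rw [twist, ← hτ, mul_inv_cancel_right]
  have h := DirichletCharacter.conductor_mul_dvd_lcm_conductor (twist hm χ k) τ⁻¹
  rw [← hχ, DirichletCharacter.conductor_inv] at h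
  have hτp : τ.conductor ∣ p := by
    rw [hτ, DirichletCharacter.conductor_changeLevel]
    exact DirichletCharacter.conductor_dvd_level _
  have h2 : d ∣ (twist hm χ k).conductor * p :=
    hcond.trans (h.trans ((Nat.lcm_dvd_mul _ _).trans (mul_dvd_mul_left _ hτp)))
  exact hd.dvd_of_dvd_mul_right h2

end Twist

/-! ### Comparison with the primitive character -/

section Primitive

variable {p d m : ℕ} {R : Type*} [CommRing R]

/-- If `d` divides the conductor, then the associated primitive character agrees with the character
modulo `d pᵐ` at the integers prime to `p`. -/
theorem primitiveCharacter_apply_of_coprime (ψ : DirichletCharacter R (d * p ^ m))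
    (hψ : d ∣ ψ.conductor) {a : ℕ} (ha : a.Coprime p) :
    ψ.primitiveCharacter (a : ZMod ψ.conductor) = ψ (a : ZMod (d * p ^ m)) := by
  by_cases had : a.Coprime d
  · have h := ψ.primitiveCharacter_apply_of_isCoprime (a := a)
      (Nat.isCoprime_iff_coprime.2 (had.mul_right (ha.pow_right m)))
    exact_mod_cast h
  -- If `a` is not prime to `d`, both values are `0`, for the primitive character because `d`
  -- divides the conductor.
  · rw [MulChar.map_nonunit, MulChar.map_nonunit]
    · rw [ZMod.isUnit_iff_coprime]
      exact fun h => had h.coprime_mul_right_right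
    · rw [ZMod.isUnit_iff_coprime]
      exact fun h => had (h.coprime_dvd_right hψ)

theorem apply_mul_prime_eq_zero (ψ : DirichletCharacter R (d * p ^ m)) [Fact p.Prime] (hm : 0 < m) (b : ℕ) :
    ψ ((p * b : ℕ) : ZMod (d * p ^ m)) = 0 := by
  refine ψ.map_nonunit ?_
  rw [ZMod.isUnit_iff_coprime, Nat.coprime_mul_iff_right, Nat.coprime_pow_right_iff hm]
  rintro ⟨-, h⟩
  exact (Fact.out : p.Prime).ne_one (h.symm.eq_one_of_dvd (dvd_mul_right p b))

end Primitive

/-! ### The Euler factor and the value of the integral -/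

section Final

variable {p d m : ℕ} [Fact p.Prime] {R : Type*} [NormedCommRing R]

/-- The two characters agree away from `p`. At `a = p b` the character `ψ` vanishes, whereas the
primitive one may not; these terms sum to the subtracted expression by multiplicativity. -/
theorem sum_range_prime_mul_eq (ψ : DirichletCharacter R (d * p ^ m)) (hψ : d ∣ ψ.conductor)
    (hm : 0 < m) (n K : ℕ) :
    ∑ a ∈ Finset.range (p * K), ψ (a : ZMod (d * p ^ m)) * (a : R) ^ n =
      ∑ a ∈ Finset.range (p * K), ψ.primitiveCharacter (a : ZMod ψ.conductor) * (a : R) ^ n -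
        ψ.primitiveCharacter (p : ZMod ψ.conductor) * (p : R) ^ n *
          ∑ a ∈ Finset.range K, ψ.primitiveCharacter (a : ZMod ψ.conductor) * (a : R) ^ n := by
  have hp := (Fact.out : p.Prime)
  rw [eq_sub_iff_add_eq, ← eq_sub_iff_add_eq', ← Finset.sum_sub_distrib, eq_comm, sum_range_mul_eq,
    Finset.sum_eq_single 0]
  · rw [Finset.mul_sum]
    refine Finset.sum_congr rfl fun k _ => ?_
    rw [zero_add, apply_mul_prime_eq_zero ψ hm]
    push_cast
    rw [map_mul]
    ring
  · intro r hr hr0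
    refine Finset.sum_eq_zero fun k _ => ?_
    rw [primitiveCharacter_apply_of_coprime ψ hψ, sub_self]
    rw [Nat.coprime_add_mul_left_left]
    exact (Nat.coprime_of_lt_prime hr0 (Finset.mem_range.1 hr) hp).symm
  · exact fun h => absurd (Finset.mem_range.2 hp.pos) h

variable [NormedAlgebra ℚ_[p] R]

/-- Reconciles the given `ℚ`-algebra structure with the one through `ℚ_p`: ring homomorphisms out of
`ℚ` are unique. -/
theorem algebraMap_rat_eq [Algebra ℚ R] (q : ℚ) :
    algebraMap ℚ R q = algebraMap ℚ_[p] R (q : ℚ_[p]) := by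
  have h : algebraMap ℚ R = (algebraMap ℚ_[p] R).comp (Rat.castHom ℚ_[p]) := Subsingleton.elim _ _
  rw [h]
  rfl

theorem generalBernoulli_eq_sum_range [Algebra ℚ R] [NeZero d] (ψ : DirichletCharacter R (d * p ^ m))
    {n : ℕ} (hn : n ≠ 1) :
    generalBernoulli ψ n = ((ψ.conductor : ℚ_[p]) ^ ((n : ℤ) - 1)) •
      ∑ r ∈ Finset.range ψ.conductor,
        (((Polynomial.bernoulli n).eval ((r : ℚ) / ψ.conductor) : ℚ) : ℚ_[p]) •
          ψ.primitiveCharacter (r : ZMod ψ.conductor) := by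
  have hf : ψ.conductor ≠ 0 := ψ.conductor_ne_zero
  set g : ℕ → R := fun r => ψ.primitiveCharacter (r : ZMod ψ.conductor) *
    algebraMap ℚ R ((Polynomial.bernoulli n).eval ((r : ℚ) / ψ.conductor)) with hg
  -- Moves the endpoint `f` of the range `1, …, f` to `0`; this needs `B_n(1) = B_n(0)`, which holds
  -- for `n ≠ 1`.
  have h0 : g ψ.conductor = g 0 := by
    have hfq : (ψ.conductor : ℚ) ≠ 0 := by exact_mod_cast hf
    simp only [hg]
    rw [ZMod.natCast_self, Nat.cast_zero, div_self hfq, Nat.cast_zero, zero_div,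
      Polynomial.bernoulli_eval_one, Polynomial.bernoulli_eval_zero,
      bernoulli_eq_bernoulli'_of_ne_one hn]
  have h1 : ∑ a ∈ Finset.Icc 1 ψ.conductor, g a = ∑ a ∈ Finset.range ψ.conductor, g a := by
    rw [Finset.range_eq_Ico, Finset.sum_eq_sum_Ico_succ_bot (Nat.pos_of_ne_zero hf), ← h0,
      add_comm, zero_add, ← Finset.sum_Ico_succ_top (Nat.one_le_iff_ne_zero.2 hf)]
    rfl
  rw [generalBernoulli, h1, algebraMap_rat_eq (p := p), Algebra.smul_def]
  congr 1
  · push_cast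
    rfl
  · refine Finset.sum_congr rfl fun r _ => ?_
    rw [Algebra.smul_def, mul_comm, ← algebraMap_rat_eq]

/-- The power sums of a Dirichlet character modulo `d pᵐ` compute the generalized Bernoulli number
with the Euler factor at `p` removed. -/
theorem tendsto_sum_character_mul_pow [NeZero d] [Algebra ℚ R] (ψ : DirichletCharacter R (d * p ^ m))
    (hψ : d ∣ ψ.conductor) (hm : 0 < m) {n : ℕ} (hn : 1 < n) :
    Tendsto (fun i => ((d * p ^ (m + (i + 1)) : ℕ) : ℚ_[p])⁻¹ •
      ∑ a ∈ Finset.range (d * p ^ (m + (i + 1))), ψ (a : ZMod (d * p ^ m)) * (a : R) ^ n) atTop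
      (𝓝 ((1 - ψ.primitiveCharacter (p : ZMod ψ.conductor) * (p : R) ^ (n - 1)) *
        generalBernoulli ψ n)) := by
  have hp0 : p ≠ 0 := (Fact.out : p.Prime).ne_zero
  have hpp : (p : ℚ_[p]) ≠ 0 := by exact_mod_cast hp0
  obtain ⟨M, hM⟩ := ψ.conductor_dvd_level
  have hM0 : M ≠ 0 := by
    rintro rfl
    exact NeZero.ne (d * p ^ m) (by simpa using hM)
  have hK : ∀ i, d * p ^ (m + i) = ψ.conductor * (M * p ^ i) := fun i => by
    calc d * p ^ (m + i) = d * p ^ m * p ^ i := by ring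
      _ = ψ.conductor * M * p ^ i := congrArg (· * p ^ i) hM
      _ = _ := by ring
  have h1 := tendsto_sum_range_periodic (p := p) ψ.conductor_ne_zero
    (fun a => ψ.primitiveCharacter (a : ZMod ψ.conductor)) (fun r k => by simp) n
    (fun i => Nat.mul_ne_zero hM0 (pow_ne_zero i hp0)) (tendsto_natCast_mul_pow M)
  rw [← generalBernoulli_eq_sum_range ψ hn.ne'] at h1
  simp_rw [← hK] at h1
  -- The primitive power sums are needed at the levels `p K` and `K` for `K = d pᵐ⁺ⁱ`, both
  -- multiples of the conductor; hence the shift by one.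
  have h2 := ((tendsto_add_atTop_iff_nat 1).2 h1).sub
    (h1.const_mul (ψ.primitiveCharacter (p : ZMod ψ.conductor) * (p : R) ^ (n - 1)))
  rw [sub_mul, one_mul]
  refine h2.congr fun i => ?_
  have hpK : d * p ^ (m + (i + 1)) = p * (d * p ^ (m + i)) := by ring
  rw [hpK, sum_range_prime_mul_eq ψ hψ hm, smul_sub]
  congr 1
  -- The normalization `(p K)⁻¹` absorbs one factor of `pⁿ`, leaving `K⁻¹ pⁿ⁻¹`.
  have hpn : (p : R) ^ n = (p : ℚ_[p]) • (p : R) ^ (n - 1) := by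
    rw [Algebra.smul_def, map_natCast, ← pow_succ', Nat.sub_add_cancel hn.le]
  rw [hpn, mul_smul_comm, mul_smul_comm, smul_mul_assoc, smul_smul, Nat.cast_mul p, mul_inv,
    mul_right_comm (p : ℚ_[p])⁻¹, inv_mul_cancel₀ hpp, one_mul]

theorem tendsto_sum_character_mul_pow_zero [NeZero d] (ψ : DirichletCharacter R (d * p ^ m))
    (n : ℕ) :
    Tendsto (fun i => ∑ a ∈ Finset.range (d * p ^ (m + (i + 1))),
      ψ (a : ZMod (d * p ^ m)) * (a : R) ^ n) atTop (𝓝 0) := by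
  have hp0 : p ≠ 0 := (Fact.out : p.Prime).ne_zero
  have h := tendsto_sum_range_periodic_zero (p := p) (NeZero.ne (d * p ^ m))
    (fun a => ψ (a : ZMod (d * p ^ m))) (fun r k => by
      rw [Nat.cast_add, Nat.cast_mul, ZMod.natCast_self, zero_mul, add_zero]) n
    (fun i => Nat.mul_ne_zero one_ne_zero (pow_ne_zero i hp0)) (tendsto_natCast_mul_pow 1)
  refine ((tendsto_add_atTop_iff_nat 1).2 h).congr fun i => ?_
  rw [one_mul, mul_assoc, ← pow_add]

variable [IsUltrametricDist R] [CompleteSpace R]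

theorem integral_charMulPow [NeZero d] [Algebra ℚ R] (hd : d.Coprime p) (c : ℕ)
    (hcd : c.Coprime d) (hcp : c.Coprime p) (hm : 0 < m) (ψ : DirichletCharacter R (d * p ^ m))
    (hψ : d ∣ ψ.conductor) {n : ℕ} (hn : 1 < n) :
    (bernoulliMeasure (R := R) c hcd hcp).integral (charMulPow hd ψ (n - 1)) =
      (1 - ψ (c : ZMod (d * p ^ m)) * (c : R) ^ n) * (algebraMap ℚ R (1 / (n : ℚ)) *
        ((1 - ψ.primitiveCharacter (p : ZMod ψ.conductor) * (p : R) ^ (n - 1)) *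
          generalBernoulli ψ n)) := by
  obtain ⟨C, hC⟩ := (Set.finite_range fun a => ‖ψ a‖).bddAbove
  have h1 := (tendsto_add_atTop_iff_nat 1).2 (tendsto_bernoulliSum_integral hd c hcd hcp hm ψ (n - 1))
  have h2 := ((tendsto_sum_character_mul_pow_zero ψ (n - 1)).const_smul
    (((c : ℚ_[p]) - 1) / 2)).add (((tendsto_sum_character_mul_pow ψ hψ hm hn).const_smul
      (n : ℚ_[p])⁻¹).const_mul (1 - ψ (c : ZMod (d * p ^ m)) * (c : R) ^ n))
  have hlim : Tendsto (fun i : ℕ => ‖((d * p ^ (m + (i + 1)) : ℕ) : ℚ_[p]) / n‖ * C) atTop (𝓝 0) := by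
    have h := ((tendsto_add_atTop_iff_nat 1).2
      (tendsto_natCast_mul_pow (p := p) (d * p ^ m))).div_const (n : ℚ_[p]) |>.norm.mul_const C
    simp only [zero_div, norm_zero, zero_mul, mul_assoc d, ← pow_add] at h
    exact h
  -- The estimate is applied to `ψ` pulled back to level `d pᵐ⁺ⁱ⁺¹`. The bound `C` serves all
  -- levels, since the pullbacks take only values of `ψ`.
  have h3 := squeeze_zero_norm (fun i => norm_bernoulliSum_sub_le (p := p) c (d * p ^ (m + (i + 1)))
    (hcd.mul_right (hcp.pow_right _))
    ((ψ.toMonoidHom).comp (ZMod.castHom (mul_dvd_mul_left d (pow_dvd_pow p (Nat.le_add_right m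
      (i + 1)))) (ZMod (d * p ^ m))).toMonoidHom)
    (fun a => hC ⟨_, rfl⟩) n (by omega)) hlim
  have h4 : Tendsto (fun i => (bernoulliSum p c (d * p ^ (m + (i + 1)))
      fun a => ψ (a : ℕ) * (a : R) ^ (n - 1)) - ((((c : ℚ_[p]) - 1) / 2) •
        ∑ a ∈ Finset.range (d * p ^ (m + (i + 1))), ψ (a : ZMod (d * p ^ m)) * (a : R) ^ (n - 1) +
        (1 - ψ (c : ZMod (d * p ^ m)) * (c : R) ^ n) * ((n : ℚ_[p])⁻¹ •
          (((d * p ^ (m + (i + 1)) : ℕ) : ℚ_[p])⁻¹ •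
          ∑ a ∈ Finset.range (d * p ^ (m + (i + 1))), ψ (a : ZMod (d * p ^ m)) * (a : R) ^ n))))
      atTop (𝓝 0) := by
    refine h3.congr fun i => ?_
    have hF : ∀ a : ℕ, ((ψ.toMonoidHom).comp (ZMod.castHom (mul_dvd_mul_left d (pow_dvd_pow p
        (Nat.le_add_right m (i + 1)))) (ZMod (d * p ^ m))).toMonoidHom)
        (a : ZMod (d * p ^ (m + (i + 1)))) = ψ (a : ZMod (d * p ^ m)) := fun a =>
      congrArg ψ (map_natCast (ZMod.castHom _ _) a)
    simp only [hF]
  -- The Riemann sums tend to the integral and the power sums to the right-hand side, so the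
  -- difference of these limits is `0`.
  have h5 := tendsto_nhds_unique h4 (h1.sub h2)
  rw [eq_comm, sub_eq_zero, smul_zero, zero_add, Algebra.smul_def] at h5
  rw [h5, algebraMap_rat_eq (p := p)]
  push_cast
  rw [one_div]

end Final

end PadicL

theorem mainTheorem1 (p : ℕ) [Fact p.Prime] (hp : p ≠ 2)
    (d : ℕ) [NeZero d] (c m : ℕ) (hd : d.Coprime p) (hcd : c.Coprime d) (hcp : c.Coprime p)
    (hm : 0 < m)
    (R : Type*) [NormedCommRing R] [IsDomain R] [CompleteSpace R] [IsUltrametricDist R]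
    [NormedAlgebra ℚ_[p] R] [Algebra ℚ R]
    (χ : DirichletCharacter R (d * p ^ m)) (hχ : χ.Even) (hcond : d ∣ χ.conductor)
    (n : ℕ) (hn : 1 < n) :
    PadicL.padicLFunction hd hm c hcd hcp χ (PadicL.angleWeight p R d (n - 1)) =
      algebraMap ℚ R (1 / (n : ℚ)) *
        (1 - χ (c : ZMod (d * p ^ m)) * PadicL.padicIntMap p R (PadicL.angle p (c : ℤ_[p])) ^ n) *
        (1 - (PadicL.twist hm χ n).primitiveCharacter (p : ZMod (PadicL.twist hm χ n).conductor) *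
          (p : R) ^ (n - 1)) *
        PadicL.generalBernoulli (PadicL.twist hm χ n) n := by
  rw [PadicL.padicLFunction, PadicL.charExtend_twist_mul_angleWeight hd hm χ (by omega),
    PadicL.integral_charMulPow hd c hcd hcp hm _ (PadicL.dvd_conductor_twist hd hm χ hcond n) hn,
    PadicL.twist_natCast_mul_pow]
  ring
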